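/- Let $\mathcal{A}$ and $\mathcal{B}$ be abelian categories that are complete and cocomplete, and let $F:\mathcal{A}\to\mathcal{B}$ be left adjoint to $G:\mathcal{B}\to\mathcal{A}$, with unit $\eta:1_{\mathcal{A}}\to GF$. A preradical of an abelian category $\mathcal{C}$ is a subobject $\sigma: S\hookrightarrow 1_{\mathcal{C}}$ of the identity functor in the category $\mathrm{Fun}(\mathcal{C},\mathcal{C})$ of endofunctors (that is, an equivalence class of monomorphisms into $1_{\mathcal{C}}$); $Pr(\mathcal{C})$ denotes the ordered collection of all preradicals of $\mathcal{C}$. Let $\psi: Pr(\mathcal{B})\to Pr(\mathcal{A})$ be the right-hand part of the Galois connection between $Pr(\mathcal{A})$ and $Pr(\mathcal{B})$ induced by the adjoint pair $(F,G)$: for $\sigma: S\hookrightarrow 1_{\mathcal{B}}$, $$\psi(\sigma)=\mathrm{Ker}\bigl(1_{\mathcal{A}}\xrightarrow{\ \eta\ }GF\xrightarrow{\ \pi_\sigma\ }\mathrm{Coker}(G\sigma F)\bigr),$$ where $G\sigma F: GSF\to GF$ has components $G(\sigma_{F(X)})$ and $\pi_\sigma$ is its cokernel in $\mathrm{Fun}(\mathcal{A},\mathcal{A})$.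 For a morphism $k:N\to M$ in a bicomplete abelian category $\mathcal{C}$, let $\mathbb{W}^N_M:\mathcal{C}\to\mathcal{C}$ be the functor $L\mapsto M^{\mathrm{Hom}_{\mathcal{C}}(L,N)}$ (product of copies of $M$), which sends $\lambda:L\to L'$ to the morphism whose component at $f\in\mathrm{Hom}_{\mathcal{C}}(L',N)$ is the projection at $f\circ\lambda$. Let $\mathbf{W}_k:1_{\mathcal{C}}\to\mathbb{W}^N_M$ be the natural transformation such that the component of $[\mathbf{W}_k]_L:L\to M^{\mathrm{Hom}_{\mathcal{C}}(L,N)}$ at each $f:L\to N$ is $k\circ f$. The omega preradical of $k$ is $\omega_k:=\mathrm{Ker}(\mathbf{W}_k)\in Pr(\mathcal{C})$. Then for every morphism $k:N\to M$ in $\mathcal{B}$, $$\psi(\omega_k)=\omega_{G(k)}\quad\text{in } Pr(\mathcal{A}).$$ -/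

import Mathlib

open CategoryTheory CategoryTheory.Limits

universe v u v₁ v₂ u₁ u₂

namespace OmegaPreradical

/-- The (possibly large) partially ordered collection `Pr(C)` of preradicals of an abelian
category `C`: subobjects of the identity functor in the category of endofunctors of `C`.
`Subobject` is the quotient of the monomorphisms into `𝟭 C` by mutual factorization. -/
abbrev Preradical (C : Type u) [Category.{v} C] : Type (max u v) :=
  Subobject (𝟭 C)

section Adjunction

variable {A : Type u₁} [Category.{v₁} A] {B : Type u₂} [Category.{v₂} B]

/-- For a natural transformation `σ : S ⟶ 1_B`, the natural transformation `GσF : GSF ⟶ GF`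
with components `G(σ_{F X})`. (The unitor only identifies `G ∘ 1_B` with `G`.) -/
def sandwich (F : A ⥤ B) (G : B ⥤ A) {S : B ⥤ B} (σ : S ⟶ 𝟭 B) : F ⋙ S ⋙ G ⟶ F ⋙ G :=
  Functor.whiskerLeft F (Functor.whiskerRight σ G ≫ G.leftUnitor.hom)

@[simp]
theorem sandwich_app (F : A ⥤ B) (G : B ⥤ A) {S : B ⥤ B} (σ : S ⟶ 𝟭 B) (X : A) :
    (sandwich F G σ).app X = G.map (σ.app (F.obj X)) := by
  simp [sandwich]

variable [Abelian A]

/-- The right-hand part `ψ : Pr(B) → Pr(A)` of the Galois connection induced by the adjoint pair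
`(F, G)` with unit `η`: `ψ(σ)` is the kernel of `π_σ ∘ η : 1_A ⟶ GF ⟶ Coker(GσF)`, computed in
the category of endofunctors of `A`. The value does not depend on the representative of `σ`
(see `psi_mk`). -/
noncomputable def psi {F : A ⥤ B} {G : B ⥤ A} (adj : F ⊣ G) (σ : Preradical B) : Preradical A :=
  kernelSubobject (adj.unit ≫ cokernel.π (sandwich F G σ.arrow))

theorem kernelSubobject_le_of_fac {F : A ⥤ B} {G : B ⥤ A} (adj : F ⊣ G) {S T : B ⥤ B}
    (σ : S ⟶ 𝟭 B) (τ : T ⟶ 𝟭 B) (ν : S ⟶ T) (h : ν ≫ τ = σ) :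
    kernelSubobject (adj.unit ≫ cokernel.π (sandwich F G σ)) ≤
      kernelSubobject (adj.unit ≫ cokernel.π (sandwich F G τ)) := by
  have hz : sandwich F G σ ≫ cokernel.π (sandwich F G τ) = 0 := by
    have : sandwich F G σ =
        Functor.whiskerLeft F (Functor.whiskerRight ν G) ≫ sandwich F G τ := by
      ext X
      simp [← h]
    rw [this, Category.assoc, cokernel.condition, comp_zero]
  have : adj.unit ≫ cokernel.π (sandwich F G τ) =
      (adj.unit ≫ cokernel.π (sandwich F G σ)) ≫ cokernel.desc _ _ hz := by
    simp
  rw [this]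
  exact kernelSubobject_comp_le _ _

/-- `ψ` may be computed with any representative `σ : S ↪ 1_B` of a preradical. -/
theorem psi_mk {F : A ⥤ B} {G : B ⥤ A} (adj : F ⊣ G) {S : B ⥤ B} (σ : S ⟶ 𝟭 B) [Mono σ] :
    psi adj (Subobject.mk σ) =
      kernelSubobject (adj.unit ≫ cokernel.π (sandwich F G σ)) :=
  le_antisymm
    (kernelSubobject_le_of_fac adj _ _ (Subobject.underlyingIso σ).hom (by simp))
    (kernelSubobject_le_of_fac adj _ _ (Subobject.underlyingIso σ).inv (by simp))

end Adjunction

section Omega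

variable {C : Type u} [Category.{v} C] [HasLimits C]

/-- The functor `𝕎 : C ⥤ C` attached to objects `N, M`, the composite of the contravariant
functors `Hom(-, N)` and `M^(-)`. It sends `L` to the power `M^{Hom(L, N)}`, and `l : L ⟶ L'` to
the morphism whose component at `f : L' ⟶ N` is the projection at `l ≫ f`. -/
noncomputable def homPower (N M : C) : C ⥤ C where
  obj L := ∏ᶜ fun _ : (L ⟶ N) => M
  map {_ L'} l := Pi.lift fun f : (L' ⟶ N) => Pi.π _ (l ≫ f)
  map_id L := by
    ext f
    simp
  map_comp l l' := by
    ext f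
    simp

/-- The natural transformation `W_k : 1_C ⟶ 𝕎` attached to `k : N ⟶ M`: the component of
`L ⟶ M^{Hom(L, N)}` at `f : L ⟶ N` is `k ∘ f`. -/
noncomputable def homPowerMap {N M : C} (k : N ⟶ M) : 𝟭 C ⟶ homPower N M where
  app L := Pi.lift fun f : (L ⟶ N) => f ≫ k
  naturality L L' l := by
    apply Pi.hom_ext
    intro f
    simp [homPower]

/-- The omega preradical `ω_k` of `k : N ⟶ M`: the kernel of `W_k : 1_C ⟶ 𝕎` in the category of
endofunctors of `C`. -/
noncomputable def omega [Abelian C] {N M : C} (k : N ⟶ M) : Preradical C :=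
  kernelSubobject (homPowerMap k)

end Omega

end OmegaPreradical

/-! Both sides are kernels, so it suffices to test maps `x : Z ⟶ X`. As a right adjoint, `G`
preserves kernels and products. By kernels, maps into `GFX` killed by `G(W_k)` factor through `G(Ker
W_k)`, so the cokernel projection kills them; the converse holds since `G(W_k)F` factors through
that projection. By products, `x ≫ η` is killed by `G(W_k)` iff `x ≫ η ≫ G f ≫ G k = 0` for all `f :
FX ⟶ N`; the maps `η ≫ G f` are exactly the maps `X ⟶ GN`, which is the condition defining `ω_{G
k}`. -/

namespace OmegaPreradical

section

variable {A : Type u₁} [Category.{v₁} A] {B : Type u₂} [Category.{v₂} B]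

/-- The projection of the power `M^{Hom(L, N)}` at `f : L ⟶ N`. -/
noncomputable def homPowerπ {C : Type u} [Category.{v} C] [HasLimits C] {N : C} (M : C) {L : C}
    (f : L ⟶ N) : (homPower N M).obj L ⟶ M :=
  Pi.π (fun _ : (L ⟶ N) => M) f

theorem homPowerMap_app_π {C : Type u} [Category.{v} C] [HasLimits C] {N M : C} (k : N ⟶ M)
    {L : C} (f : L ⟶ N) :
    (homPowerMap k).app L ≫ homPowerπ M f = f ≫ k :=
  Pi.lift_π _ _

theorem comp_homPowerMap_app_eq_zero_iff {C : Type u} [Category.{v} C] [HasLimits C]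
    [HasZeroMorphisms C] {N M : C} (k : N ⟶ M) {Z L : C} (x : Z ⟶ L) :
    x ≫ (homPowerMap k).app L = 0 ↔ ∀ f : L ⟶ N, x ≫ f ≫ k = 0 := by
  refine ⟨fun h f => ?_, fun h => Pi.hom_ext _ _ fun f => ?_⟩
  · rw [← homPowerMap_app_π k f]
    exact (Category.assoc _ _ _).symm.trans ((congrArg (· ≫ homPowerπ M f) h).trans zero_comp)
  · change (x ≫ (homPowerMap k).app L) ≫ homPowerπ M f = 0 ≫ homPowerπ M f
    rw [zero_comp, ← h f, ← homPowerMap_app_π k f]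
    exact Category.assoc _ _ _

/-- Since `G` preserves the power, the images under `G` of its projections are jointly monic. -/
theorem comp_map_homPowerMap_app_eq_zero_iff [HasLimits B] [HasZeroMorphisms A]
    {F : A ⥤ B} {G : B ⥤ A} (adj : F ⊣ G) {N M : B} (k : N ⟶ M)
    {Z : A} {L : B} (y : Z ⟶ G.obj L) :
    y ≫ G.map ((homPowerMap k).app L) = 0 ↔ ∀ f : L ⟶ N, y ≫ G.map f ≫ G.map k = 0 := by
  have : PreservesLimitsOfSize.{v₂, v₂} G := adj.rightAdjoint_preservesLimits
  have key (f : L ⟶ N) : (y ≫ G.map ((homPowerMap k).app L)) ≫ G.map (homPowerπ M f) =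
      y ≫ G.map f ≫ G.map k := by
    rw [← G.map_comp, ← homPowerMap_app_π k f, G.map_comp]
    exact Category.assoc _ _ _
  refine ⟨fun h f => by rw [← key, h, zero_comp], fun h => ?_⟩
  refine Fan.IsLimit.hom_ext
    (isLimitFanMkObjOfIsLimit G _ _ (productIsProduct fun _ : (L ⟶ N) => M)) _ _ fun f => ?_
  change (y ≫ G.map ((homPowerMap k).app L)) ≫ G.map (homPowerπ M f) = 0 ≫ G.map (homPowerπ M f)
  rw [key, h, zero_comp]

/-- The unit of the adjunction turns maps `F X ⟶ N` into all maps `X ⟶ G N`. -/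
theorem comp_unit_comp_map_homPowerMap_app_eq_zero_iff [HasLimits A] [HasLimits B]
    [HasZeroMorphisms A] {F : A ⥤ B} {G : B ⥤ A} (adj : F ⊣ G) {N M : B} (k : N ⟶ M)
    {Z X : A} (x : Z ⟶ X) :
    (x ≫ adj.unit.app X) ≫ G.map ((homPowerMap k).app (F.obj X)) = 0 ↔
      x ≫ (homPowerMap (G.map k)).app X = 0 := by
  rw [comp_map_homPowerMap_app_eq_zero_iff adj, comp_homPowerMap_app_eq_zero_iff,
    ← (adj.homEquiv X N).forall_congr_right]
  simp [Adjunction.homEquiv_unit]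

/-- A right adjoint preserves the components of kernels of natural transformations. -/
theorem exists_fac_map_kernel_ι_app [Abelian A] [Abelian B]
    {F : A ⥤ B} {G : B ⥤ A} (adj : F ⊣ G) {S T : B ⥤ B} (α : S ⟶ T) (Y : B)
    {Z : A} (y : Z ⟶ G.obj (S.obj Y)) (h : y ≫ G.map (α.app Y) = 0) :
    ∃ l : Z ⟶ G.obj ((kernel α).obj Y), l ≫ G.map ((kernel.ι α).app Y) = y := by
  have : PreservesLimitsOfSize.{0, 0} G := adj.rightAdjoint_preservesLimits
  have := adj.isRightAdjoint
  -- Kernels of natural transformations are pointwise, so evaluation at `Y` followed by `G`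
  -- preserves them.
  let H := (evaluation B B).obj Y ⋙ G
  have : H.PreservesZeroMorphisms := ⟨fun _ _ => G.map_zero _ _⟩
  let l := KernelFork.IsLimit.lift' (KernelFork.mapIsLimit _ (kernelIsKernel α) H) y h
  exact ⟨l.1, l.2⟩

theorem psi_omega [Abelian A] [HasLimits A] [Abelian B] [HasLimits B]
    {F : A ⥤ B} {G : B ⥤ A} (adj : F ⊣ G) {N M : B} (k : N ⟶ M) :
    psi adj (omega k) = omega (G.map k) := by
  have := adj.isRightAdjoint
  -- Take the kernel inclusion itself as representative of `ω_k`.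
  rw [omega, kernelSubobject, psi_mk]
  apply le_antisymm
  · apply le_kernelSubobject
    set i := (kernelSubobject (adj.unit ≫
      cokernel.π (sandwich F G (kernel.ι (homPowerMap k))))).arrow with hi
    -- This makes `G(W_k)F` factor through the cokernel in `ψ`.
    have hz : sandwich F G (kernel.ι (homPowerMap k)) ≫
        Functor.whiskerLeft F (Functor.whiskerRight (homPowerMap k) G) = 0 := by
      ext X
      have := NatTrans.congr_app (kernel.condition (homPowerMap k)) (F.obj X)
      simp only [NatTrans.comp_app] at this
      simp only [NatTrans.comp_app, sandwich_app, Functor.whiskerLeft_app,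
        Functor.whiskerRight_app]
      exact (G.map_comp _ _).symm.trans ((congrArg G.map this).trans (G.map_zero _ _))
    have h : (i ≫ adj.unit) ≫
        Functor.whiskerLeft F (Functor.whiskerRight (homPowerMap k) G) = 0 := by
      rw [← cokernel.π_desc _ _ hz, Category.assoc, ← Category.assoc adj.unit, ← Category.assoc,
        hi, kernelSubobject_arrow_comp, zero_comp]
    ext X
    exact (comp_unit_comp_map_homPowerMap_app_eq_zero_iff adj k (i.app X)).1
      (NatTrans.congr_app h X)
  · apply le_kernelSubobject
    ext X
    have h : (omega (G.map k)).arrow ≫ homPowerMap (G.map k) = 0 :=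
      kernelSubobject_arrow_comp _
    -- On `ω_{G k}`, the unit lifts through `G(Ker W_k)`, which the cokernel projection kills.
    obtain ⟨l, hl⟩ := exists_fac_map_kernel_ι_app adj (homPowerMap k) (F.obj X) _
      ((comp_unit_comp_map_homPowerMap_app_eq_zero_iff adj k
        ((omega (G.map k)).arrow.app X)).2 (NatTrans.congr_app h X))
    have hc := NatTrans.congr_app
      (cokernel.condition (sandwich F G (kernel.ι (homPowerMap k)))) X
    rw [NatTrans.comp_app, sandwich_app] at hc
    simp only [NatTrans.comp_app]
    refine (Category.assoc _ _ _).symm.trans ?_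
    refine (congrArg (· ≫ _) hl.symm).trans ((Category.assoc _ _ _).trans ?_)
    exact (congrArg (l ≫ ·) hc).trans comp_zero

end

end OmegaPreradical

theorem proposition6p12
    {A : Type u₁} [Category.{v₁} A] [Abelian A] [HasLimits A] [HasColimits A]
    {B : Type u₂} [Category.{v₂} B] [Abelian B] [HasLimits B] [HasColimits B]
    {F : A ⥤ B} {G : B ⥤ A} (adj : F ⊣ G) {N M : B} (k : N ⟶ M) :
    OmegaPreradical.psi adj (OmegaPreradical.omega k) = OmegaPreradical.omega (G.map k) :=
  OmegaPreradical.psi_omega adj k
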